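/- Let $\lambda>0$, $\kappa=2\pi/\lambda$, and let $\mathbf u_{s,1},\dots,\mathbf u_{s,N_s}\in\mathbb R^3$, $s\in\{\mathrm{rx},\mathrm{tx}\}$, be the antenna positions of a receive and a transmit array. Each array is planar and lies, in its own coordinate system, in a plane parallel to the $\mathsf y$-$\mathsf z$ plane (the $\mathsf x$-axis points into the half-space in front of the array). For an angle pair $\boldsymbol\Psi=(\theta,\phi)$ put $\mathbf d(\boldsymbol\Psi)=[\cos\theta\cos\phi,\ \cos\theta\sin\phi,\ \sin\theta]^{\mathsf T}$ and let $\mathbf a_s(\boldsymbol\Psi)\in\mathbb C^{N_s}$ be the steering vector with entries $\mathrm e^{\mathrm j\kappa\,\mathbf d(\boldsymbol\Psi)^{\mathsf T}\mathbf u_{s,n}}$. Consider $$\mathbf H^{\mathrm{nLOS}}=\mathbf H^{\mathrm{nLOS}}_L=\frac1{\sqrt L}\sum_{\ell=1}^L c^{(\ell)}\,\mathbf a_{\mathrm{rx}}(\boldsymbol\Psi^{(\ell)}_{\mathrm{rx}})\,\mathbf a_{\mathrm{tx}}^{\mathsf H}(\boldsymbol\Psi^{(\ell)}_{\mathrm{tx}}),$$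 where all the random variables $c^{(\ell)},\boldsymbol\Psi_{\mathrm{rx}}^{(\ell)},\boldsymbol\Psi_{\mathrm{tx}}^{(\ell)}$ $(\ell\ge1)$ are mutually independent and (A1) the complex path gains $c^{(\ell)}$ are identically distributed with $\mathbb E\{c^{(\ell)}\}=0$ and $\mathbb E\{|c^{(\ell)}|^2\}=\sigma_c^2<\infty$, $\sigma_c\ge 0$; (A2) all the angle pairs $\boldsymbol\Psi_{\mathrm{rx}}^{(\ell)},\boldsymbol\Psi_{\mathrm{tx}}^{(\ell)}$ have the density $f(\theta,\phi)=\frac{\cos\theta}{2\pi}$ on $[-\frac\pi2,\frac\pi2]\times[-\frac\pi2,\frac\pi2]$. Let $[\mathbf R_s]_{m,n}=\mathrm{sinc}\big(\kappa\|\mathbf u_{s,m}-\mathbf u_{s,n}\|\big)$, where $\mathrm{sinc}(x)=\sin(x)/x$ and $\mathrm{sinc}(0)=1$. Then, as $L\to\infty$, $\mathbf H^{\mathrm{nLOS}}_L$ converges in distribution to a complex Gaussian random matrix $\mathbf G\in\mathbb C^{N_{\mathrm{rx}}\times N_{\mathrm{tx}}}$ (the real and imaginary parts of its entries are jointly Gaussian)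 with mean $\mathbf 0$ and Kronecker covariance $$\mathbb E\big\{[\mathbf G]_{i,j}\,[\mathbf G]_{k,l}^*\big\}=[\sigma_c\mathbf R_{\mathrm{rx}}]_{i,k}\,[\sigma_c\mathbf R_{\mathrm{tx}}]_{l,j}\qquad\text{for all } i,j,k,l.$$ If moreover the path gains are proper, that is, $\mathbb E\{(c^{(\ell)})^2\}=0$ (for example, if they are circularly symmetric), then also $\mathbb E\{[\mathbf G]_{i,j}[\mathbf G]_{k,l}\}=0$ for all $i,j,k,l$; that is, $\mathbf G$ has the circularly symmetric matrix complex normal distribution $\mathcal{MCN}(\mathbf 0_{N_{\mathrm{rx}},N_{\mathrm{tx}}},\sigma_c\mathbf R_{\mathrm{rx}},\sigma_c\mathbf R_{\mathrm{tx}})$. -/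

import Mathlib

open MeasureTheory ProbabilityTheory Filter Topology
open scoped ComplexConjugate

/-- The product (= Borel) σ-algebra on the space of complex `m × n` matrices. -/
noncomputable instance instMeasurableSpaceComplexMatrix (m n : ℕ) :
    MeasurableSpace (Matrix (Fin m) (Fin n) ℂ) :=
  inferInstanceAs (MeasurableSpace (Fin m → Fin n → ℂ))

instance instBorelSpaceComplexMatrix (m n : ℕ) :
    BorelSpace (Matrix (Fin m) (Fin n) ℂ) :=
  inferInstanceAs (BorelSpace (Fin m → Fin n → ℂ))

/-- The wave number `κ = 2π / lam` of the wavelength `lam`. -/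
noncomputable def waveNumber (lam : ℝ) : ℝ := 2 * Real.pi / lam

/-- The unit vector pointing towards `Ψ = (θ, φ)` (elevation, azimuth), in the coordinate system
of the array; the half-space in front of the array is `x > 0`. -/
noncomputable def direction (Ψ : ℝ × ℝ) : EuclideanSpace ℝ (Fin 3) :=
  !₂[Real.cos Ψ.1 * Real.cos Ψ.2, Real.cos Ψ.1 * Real.sin Ψ.2, Real.sin Ψ.1]

/-- The array lies in a plane parallel to the `y`-`z` plane of its coordinate system, that is, the
boundary plane of the half-space in front of it. -/
def IsPlanarArray {N : ℕ} (u : Fin N → EuclideanSpace ℝ (Fin 3)) : Prop :=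
  ∀ m n, u m 0 = u n 0

/-- The steering vector, with entries `exp (j κ d(Ψ)ᵀ u_n)`. -/
noncomputable def steeringVector (κ : ℝ) {N : ℕ} (u : Fin N → EuclideanSpace ℝ (Fin 3))
    (Ψ : ℝ × ℝ) : Fin N → ℂ :=
  fun n => Complex.exp (Complex.I * ((κ * inner ℝ (direction Ψ) (u n) : ℝ) : ℂ))

/-- The law of an angle pair `Ψ = (θ, φ)`: density `cos θ / (2π)` on `[-π/2, π/2]²`. -/
noncomputable def angleLaw : Measure (ℝ × ℝ) :=
  ((volume : Measure (ℝ × ℝ)).restrict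
      (Set.Icc (-(Real.pi / 2)) (Real.pi / 2) ×ˢ Set.Icc (-(Real.pi / 2)) (Real.pi / 2))).withDensity
    fun Ψ => ENNReal.ofReal (Real.cos Ψ.1 / (2 * Real.pi))

/-- The non-line-of-sight channel matrix with `L` paths,
`L^(-1/2) ∑_ℓ c_ℓ a_rx(Ψrx_ℓ) a_tx(Ψtx_ℓ)ᴴ`, the paths being numbered `0, …, L - 1`. -/
noncomputable def nlosChannel {Ω : Type*} (κ : ℝ) {Nrx Ntx : ℕ}
    (urx : Fin Nrx → EuclideanSpace ℝ (Fin 3)) (utx : Fin Ntx → EuclideanSpace ℝ (Fin 3))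
    (c : ℕ → Ω → ℂ) (Ψrx Ψtx : ℕ → Ω → ℝ × ℝ) (L : ℕ) (ω : Ω) :
    Matrix (Fin Nrx) (Fin Ntx) ℂ :=
  ((1 / Real.sqrt L : ℝ) : ℂ) • ∑ ℓ ∈ Finset.range L,
    c ℓ ω • Matrix.vecMulVec (steeringVector κ urx (Ψrx ℓ ω))
      (star (steeringVector κ utx (Ψtx ℓ ω)))

/-- The spatial correlation matrix, with entries `sinc (κ ‖u_m - u_n‖)`. -/
noncomputable def correlationMatrix (κ : ℝ) {N : ℕ} (u : Fin N → EuclideanSpace ℝ (Fin 3)) :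
    Matrix (Fin N) (Fin N) ℂ :=
  Matrix.of fun m n => ((Real.sinc (κ * ‖u m - u n‖) : ℝ) : ℂ)

/-- `ν` is the law of a complex Gaussian matrix `G` (real and imaginary parts of all entries are
jointly Gaussian) with mean `M` and Kronecker covariance:
`E[(G - M)_{ij} conj (G - M)_{kl}] = U_{ik} V_{lj}`. -/
structure IsGaussianMatrixLaw {m n : ℕ} (M : Matrix (Fin m) (Fin n) ℂ)
    (U : Matrix (Fin m) (Fin m) ℂ) (V : Matrix (Fin n) (Fin n) ℂ)
    (ν : Measure (Matrix (Fin m) (Fin n) ℂ)) : Prop where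
  gaussian : IsGaussian ν
  mean : ∀ i j, ∫ G, G i j ∂ν = M i j
  covariance : ∀ i k j l, ∫ G, (G i j - M i j) * conj (G k l - M k l) ∂ν = U i k * V l j

/-- `ν` is the circularly symmetric matrix complex normal distribution `MCN(M, U, V)`: Gaussian
with mean `M`, Kronecker covariance given by `U` and `V`, and vanishing pseudo-covariance. -/
structure IsMatrixComplexNormal {m n : ℕ} (M : Matrix (Fin m) (Fin n) ℂ)
    (U : Matrix (Fin m) (Fin m) ℂ) (V : Matrix (Fin n) (Fin n) ℂ)
    (ν : Measure (Matrix (Fin m) (Fin n) ℂ)) : Prop extends IsGaussianMatrixLaw M U V ν where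
  pseudoCovariance : ∀ i k j l, ∫ G, (G i j - M i j) * (G k l - M k l) ∂ν = 0

/-! The summands `c a_rx a_txᴴ` are i.i.d. and centred, and their entries have modulus `|c|`, so
they are square integrable. The multivariate central limit theorem
(`exists_tendstoInDistribution_matrix`) then gives a Gaussian limit with the second moments of one
summand. By independence these factor into a moment of the gain and one angular integral per array;
the pseudo-covariance carries the factor `E c²`, which vanishes for proper gains.

The angular integral is a sinc (`integral_steeringVector_mul_conj`). The angle law is the uniform
law on the half-sphere, and a planar array sees only its projection to the boundary plane. That
projection has density `1 / (2π √(1 - |q|²))` on the unit disk, which is rotation invariant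
(`integral_cos_smul_rotatedProjection`). So the difference of two antenna positions may be rotated
onto the `z`-axis, where the phase involves only `sin θ`, which is uniform on `[-1, 1]`. -/

/-! ### Rotation invariance of the projected half-sphere, and the sinc integral. -/

/-- The projection of the half-sphere point with elevation and azimuth `p` to the boundary plane of
the half-space, rotated by the angle `α`. -/
noncomputable def rotatedProjection (α : ℝ) (p : ℝ × ℝ) : ℝ × ℝ :=
  (Real.cos α * (Real.cos p.1 * Real.sin p.2) - Real.sin α * Real.sin p.1,
    Real.sin α * (Real.cos p.1 * Real.sin p.2) + Real.cos α * Real.sin p.1)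

/-- The derivative of `rotatedProjection α`. -/
noncomputable def fderivRotatedProjection (α : ℝ) (p : ℝ × ℝ) : ℝ × ℝ →L[ℝ] ℝ × ℝ :=
  LinearMap.toContinuousLinearMap (Matrix.toLin (Module.Basis.finTwoProd ℝ)
    (Module.Basis.finTwoProd ℝ)
    !![-(Real.cos α * (Real.sin p.1 * Real.sin p.2)) - Real.sin α * Real.cos p.1,
        Real.cos α * (Real.cos p.1 * Real.cos p.2);
      -(Real.sin α * (Real.sin p.1 * Real.sin p.2)) + Real.cos α * Real.cos p.1,
        Real.sin α * (Real.cos p.1 * Real.cos p.2)])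

lemma hasFDerivAt_rotatedProjection (α : ℝ) (p : ℝ × ℝ) :
    HasFDerivAt (rotatedProjection α) (fderivRotatedProjection α p) p := by
  unfold fderivRotatedProjection
  rw [Matrix.toLin_finTwoProd_toContinuousLinearMap]
  have h1 : HasFDerivAt (fun p : ℝ × ℝ => p.1) (ContinuousLinearMap.fst ℝ ℝ ℝ) p := hasFDerivAt_fst
  have h2 : HasFDerivAt (fun p : ℝ × ℝ => p.2) (ContinuousLinearMap.snd ℝ ℝ ℝ) p := hasFDerivAt_snd
  have hy := h1.cos.mul h2.sin
  convert! HasFDerivAt.prodMk ((hy.const_mul (Real.cos α)).sub (h1.sin.const_mul (Real.sin α)))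
    ((hy.const_mul (Real.sin α)).add (h1.sin.const_mul (Real.cos α))) using 2 <;>
  · ext <;> simp [mul_comm (Real.sin p.2)]

/-- A rotation has determinant one, so `α` drops out. -/
lemma det_fderivRotatedProjection (α : ℝ) (p : ℝ × ℝ) :
    (fderivRotatedProjection α p).det = -(Real.cos p.1 ^ 2 * Real.cos p.2) := by
  unfold fderivRotatedProjection
  rw [LinearMap.det_toContinuousLinearMap, LinearMap.det_toLin, Matrix.det_fin_two_of]
  linear_combination (-(Real.cos p.1 ^ 2 * Real.cos p.2)) * Real.sin_sq_add_cos_sq α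

/-- The open square of elevations and azimuths. -/
def angleSquare : Set (ℝ × ℝ) :=
  Set.Ioo (-(Real.pi / 2)) (Real.pi / 2) ×ˢ Set.Ioo (-(Real.pi / 2)) (Real.pi / 2)

lemma measurableSet_angleSquare : MeasurableSet angleSquare :=
  measurableSet_Ioo.prod measurableSet_Ioo

/-- The omitted coordinate of the unit vector is `cos θ cos φ`. The Jacobian is `cos θ` times it,
which makes the density on the disk a function of the radius alone. -/
lemma rotatedProjection_sq_add_sq (α : ℝ) (p : ℝ × ℝ) :
    (rotatedProjection α p).1 ^ 2 + (rotatedProjection α p).2 ^ 2 =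
      1 - (Real.cos p.1 * Real.cos p.2) ^ 2 := by
  simp only [rotatedProjection]
  linear_combination (Real.cos p.1 ^ 2 * Real.sin p.2 ^ 2 + Real.sin p.1 ^ 2) *
    Real.sin_sq_add_cos_sq α + Real.cos p.1 ^ 2 * Real.sin_sq_add_cos_sq p.2 +
    Real.sin_sq_add_cos_sq p.1

lemma injOn_rotatedProjection (α : ℝ) : Set.InjOn (rotatedProjection α) angleSquare := by
  rintro ⟨θ, φ⟩ ⟨hθ, hφ⟩ ⟨θ', φ'⟩ ⟨hθ', hφ'⟩ h
  simp only [rotatedProjection, Prod.mk.injEq] at h hθ hφ hθ' hφ'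
  obtain ⟨h1, h2⟩ := h
  have hα := Real.sin_sq_add_cos_sq α
  have hs : Real.sin θ = Real.sin θ' := by
    linear_combination (-Real.sin α) * h1 + Real.cos α * h2 - (Real.sin θ - Real.sin θ') * hα
  have e : θ = θ' := Real.injOn_sin (Set.Ioo_subset_Icc_self hθ) (Set.Ioo_subset_Icc_self hθ') hs
  subst e
  have hy : Real.cos θ * Real.sin φ = Real.cos θ * Real.sin φ' := by
    linear_combination Real.cos α * h1 + Real.sin α * h2 -
      (Real.cos θ * Real.sin φ - Real.cos θ * Real.sin φ') * hα
  have e : φ = φ' := Real.injOn_sin (Set.Ioo_subset_Icc_self hφ) (Set.Ioo_subset_Icc_self hφ')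
    (mul_left_cancel₀ (Real.cos_pos_of_mem_Ioo hθ).ne' hy)
  rw [e]

lemma image_rotatedProjection (α : ℝ) :
    rotatedProjection α '' angleSquare = {q : ℝ × ℝ | q.1 ^ 2 + q.2 ^ 2 < 1} := by
  ext ⟨x, y⟩
  constructor
  · rintro ⟨⟨θ, φ⟩, ⟨hθ, hφ⟩, h⟩
    have hsq := rotatedProjection_sq_add_sq α (θ, φ)
    rw [h] at hsq
    have hpos := mul_pos (Real.cos_pos_of_mem_Ioo hθ) (Real.cos_pos_of_mem_Ioo hφ)
    simp only [Set.mem_ofPred_eq, hsq]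
    have := pow_pos hpos 2
    linarith
  · intro h
    simp only [Set.mem_ofPred_eq] at h
    have hα := Real.sin_sq_add_cos_sq α
    -- Rotating back by `-α`: a preimage must satisfy `u = cos θ sin φ` and `v = sin θ`, hence `sin
    -- φ = w` below.
    set u := Real.cos α * x + Real.sin α * y with hu
    set v := -Real.sin α * x + Real.cos α * y with hv
    have huv : u ^ 2 + v ^ 2 < 1 := by
      have : u ^ 2 + v ^ 2 = x ^ 2 + y ^ 2 := by
        rw [hu, hv]; linear_combination (x ^ 2 + y ^ 2) * hα
      linarith
    have hv1 : -1 < v ∧ v < 1 := abs_lt.1 ((sq_lt_one_iff_abs_lt_one v).1 (by nlinarith [sq_nonneg u]))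
    have hc : 0 < Real.cos (Real.arcsin v) :=
      Real.cos_arcsin v ▸ Real.sqrt_pos.2 (by nlinarith [sq_nonneg u])
    have hc2 : Real.cos (Real.arcsin v) ^ 2 = 1 - v ^ 2 := by
      rw [Real.cos_arcsin, Real.sq_sqrt (by nlinarith [sq_nonneg u])]
    set w := u / Real.cos (Real.arcsin v) with hw
    have hw1 : -1 < w ∧ w < 1 := by
      refine abs_lt.1 ((sq_lt_one_iff_abs_lt_one w).1 ?_)
      rw [hw, div_pow, div_lt_one (by positivity), hc2]
      linarith
    have hsv := Real.sin_arcsin hv1.1.le hv1.2.le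
    have hsw := Real.sin_arcsin hw1.1.le hw1.2.le
    have huw : Real.cos (Real.arcsin v) * w = u := by rw [hw]; field_simp
    refine ⟨(Real.arcsin v, Real.arcsin w),
      ⟨⟨Real.neg_pi_div_two_lt_arcsin.2 hv1.1, Real.arcsin_lt_pi_div_two.2 hv1.2⟩,
        ⟨Real.neg_pi_div_two_lt_arcsin.2 hw1.1, Real.arcsin_lt_pi_div_two.2 hw1.2⟩⟩, ?_⟩
    simp only [rotatedProjection, hsv, hsw, huw, Prod.mk.injEq]
    constructor
    · rw [hu, hv]; linear_combination x * hα
    · rw [hu, hv]; linear_combination y * hα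

/-- The point is that the right-hand side is free of `α`, so the left-hand sides for any two angles
agree. -/
lemma integral_cos_smul_rotatedProjection (α : ℝ) (h : ℝ × ℝ → ℂ) :
    ∫ p in angleSquare, Real.cos p.1 • h (rotatedProjection α p) =
      ∫ q in {q : ℝ × ℝ | q.1 ^ 2 + q.2 ^ 2 < 1}, (√(1 - (q.1 ^ 2 + q.2 ^ 2)))⁻¹ • h q := by
  rw [← image_rotatedProjection α, integral_image_eq_integral_abs_det_fderiv_smul volume
    measurableSet_angleSquare (fun p _ => (hasFDerivAt_rotatedProjection α p).hasFDerivWithinAt)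
    (injOn_rotatedProjection α)]
  refine setIntegral_congr_fun measurableSet_angleSquare fun p hp => ?_
  have hθ := Real.cos_pos_of_mem_Ioo hp.1
  have hφ := Real.cos_pos_of_mem_Ioo hp.2
  simp only [rotatedProjection_sq_add_sq, det_fderivRotatedProjection, smul_smul]
  congr 1
  rw [sub_sub_cancel, Real.sqrt_sq (by positivity), abs_neg, abs_of_pos (by positivity)]
  field_simp

/-- The integrand is the derivative of `exp (i r sin θ) / (i r)`; this needs `r ≠ 0`, so `r = 0` is
treated apart. -/
lemma integral_cos_mul_exp_sin (r : ℝ) :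
    ∫ θ in (-(Real.pi / 2))..(Real.pi / 2),
      (Real.cos θ : ℂ) * Complex.exp (Complex.I * ((r * Real.sin θ : ℝ) : ℂ)) =
      ((2 * Real.sinc r : ℝ) : ℂ) := by
  rcases eq_or_ne r 0 with rfl | hr
  · simp only [zero_mul, Complex.ofReal_zero, mul_zero, Complex.exp_zero, mul_one, Real.sinc_zero]
    rw [intervalIntegral.integral_ofReal, integral_cos]
    simp
    norm_num
  have hr' : (r : ℂ) ≠ 0 := Complex.ofReal_ne_zero.2 hr
  have hd : ∀ θ ∈ Set.uIcc (-(Real.pi / 2)) (Real.pi / 2), HasDerivAt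
      (fun θ : ℝ => Complex.exp (Complex.I * ((r * Real.sin θ : ℝ) : ℂ)) / (Complex.I * r))
      ((Real.cos θ : ℂ) * Complex.exp (Complex.I * ((r * Real.sin θ : ℝ) : ℂ))) θ := by
    intro θ _
    convert! (((((Real.hasDerivAt_sin θ).const_mul r).ofReal_comp).const_mul
      Complex.I).cexp.div_const (Complex.I * r)) using 1
    push_cast
    field_simp
  rw [intervalIntegral.integral_eq_sub_of_hasDerivAt hd
    (Continuous.intervalIntegrable (by fun_prop) _ _), Real.sinc_of_ne_zero hr]
  simp only [Real.sin_neg, Real.sin_pi_div_two, mul_one, mul_neg]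
  push_cast
  rw [Complex.sin]
  field_simp
  ring_nf
  simp
  ring

lemma integral_angleSquare_cos_smul_exp_sin (r : ℝ) :
    ∫ p in angleSquare, Real.cos p.1 • Complex.exp (Complex.I * ((r * Real.sin p.1 : ℝ) : ℂ)) =
      ((2 * Real.pi * Real.sinc r : ℝ) : ℂ) := by
  have hint := integral_cos_mul_exp_sin r
  rw [intervalIntegral.integral_of_le (by linarith [Real.pi_pos]),
    integral_Ioc_eq_integral_Ioo] at hint
  have := setIntegral_prod_mul (μ := (volume : Measure ℝ)) (ν := (volume : Measure ℝ))
    (fun θ : ℝ => (Real.cos θ : ℂ) * Complex.exp (Complex.I * ((r * Real.sin θ : ℝ) : ℂ)))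
    (fun _ => (1 : ℂ)) (Set.Ioo (-(Real.pi / 2)) (Real.pi / 2))
    (Set.Ioo (-(Real.pi / 2)) (Real.pi / 2))
  rw [hint] at this
  simp only [mul_one, integral_const, ← Measure.volume_eq_prod] at this
  simp only [angleSquare, Complex.real_smul]
  rw [this]
  simp [Real.volume_real_Ioo_of_le (show -(Real.pi / 2) ≤ Real.pi / 2 by linarith [Real.pi_pos])]
  ring

/-- The boundary of the square is null; on the open square the cosine is positive and the projection
injective. -/
lemma integral_angleLaw (g : ℝ × ℝ → ℂ) :
    ∫ p, g p ∂angleLaw = (((2 * Real.pi)⁻¹ : ℝ) : ℂ) *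
      ∫ p in angleSquare, Real.cos p.1 • g p := by
  rw [angleLaw, integral_withDensity_eq_integral_toReal_smul (by fun_prop)
    (ae_of_all _ fun _ => ENNReal.ofReal_lt_top)]
  have hae : (Set.Icc (-(Real.pi / 2)) (Real.pi / 2) ×ˢ Set.Icc (-(Real.pi / 2)) (Real.pi / 2) :
      Set (ℝ × ℝ)) =ᵐ[volume] angleSquare :=
    (Measure.set_prod_ae_eq Ioo_ae_eq_Icc Ioo_ae_eq_Icc).symm
  rw [setIntegral_congr_set hae, ← integral_const_mul]
  refine setIntegral_congr_fun measurableSet_angleSquare fun p hp => ?_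
  have hθ := Real.cos_pos_of_mem_Ioo hp.1
  have := Real.pi_pos
  simp only [Complex.real_smul]
  rw [ENNReal.toReal_ofReal (by positivity)]
  push_cast
  ring

/-- The characteristic function of the projection to the boundary plane of a uniform random point
of the half-sphere. -/
lemma integral_angleLaw_exp (r a b : ℝ) :
    ∫ p, Complex.exp (Complex.I *
      ((r * (a * (Real.cos p.1 * Real.sin p.2) + b * Real.sin p.1) : ℝ) : ℂ)) ∂angleLaw =
      ((Real.sinc (r * √(a ^ 2 + b ^ 2)) : ℝ) : ℂ) := by
  -- With `α` the polar angle of `(b, a)`, the linear form becomes `s` times the second coordinate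
  -- of `rotatedProjection α`.
  obtain ⟨α, ha, hb⟩ : ∃ α : ℝ, a = √(a ^ 2 + b ^ 2) * Real.sin α ∧
      b = √(a ^ 2 + b ^ 2) * Real.cos α := by
    have hn : ‖(⟨b, a⟩ : ℂ)‖ = √(a ^ 2 + b ^ 2) := by
      rw [Complex.norm_def, Complex.normSq_mk]; congr 1; ring
    refine ⟨Complex.arg ⟨b, a⟩, ?_, ?_⟩ <;> rw [← hn]
    · exact (Complex.norm_mul_sin_arg ⟨b, a⟩).symm
    · exact (Complex.norm_mul_cos_arg ⟨b, a⟩).symm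
  set s := √(a ^ 2 + b ^ 2)
  -- Pass from `α` to `0`, where the second coordinate is `sin θ`.
  have key := (integral_cos_smul_rotatedProjection α
    (fun q => Complex.exp (Complex.I * ((r * s * q.2 : ℝ) : ℂ)))).trans
    (integral_cos_smul_rotatedProjection 0
    (fun q => Complex.exp (Complex.I * ((r * s * q.2 : ℝ) : ℂ)))).symm
  simp only [rotatedProjection, Real.sin_zero, Real.cos_zero, zero_mul, one_mul, zero_add] at key
  rw [integral_angleSquare_cos_smul_exp_sin] at key
  rw [integral_angleLaw]
  have hfun : ∀ p : ℝ × ℝ, r * (a * (Real.cos p.1 * Real.sin p.2) + b * Real.sin p.1) =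
      r * s * (Real.sin α * (Real.cos p.1 * Real.sin p.2) + Real.cos α * Real.sin p.1) := by
    intro p; rw [ha, hb]; ring
  simp only [hfun]
  rw [key]
  have := Real.pi_pos
  rw [← Complex.ofReal_mul]
  congr 1
  field_simp

/-- Planarity removes the `x`-component of `u m - u n`, the one direction in which the half-sphere
is not symmetric. -/
lemma integral_steeringVector_mul_conj (κ : ℝ) {N : ℕ} {u : Fin N → EuclideanSpace ℝ (Fin 3)}
    (hu : IsPlanarArray u) (m n : Fin N) :
    ∫ Ψ, steeringVector κ u Ψ m * conj (steeringVector κ u Ψ n) ∂angleLaw =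
      correlationMatrix κ u m n := by
  have hx : (u m - u n) 0 = 0 := by simp [hu m n]
  have hfun : ∀ Ψ : ℝ × ℝ, steeringVector κ u Ψ m * conj (steeringVector κ u Ψ n) =
      Complex.exp (Complex.I * ((κ * ((u m - u n) 1 * (Real.cos Ψ.1 * Real.sin Ψ.2) +
        (u m - u n) 2 * Real.sin Ψ.1) : ℝ) : ℂ)) := by
    intro Ψ
    have hin : inner ℝ (direction Ψ) (u m) - inner ℝ (direction Ψ) (u n) =
        (u m - u n) 1 * (Real.cos Ψ.1 * Real.sin Ψ.2) + (u m - u n) 2 * Real.sin Ψ.1 := by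
      rw [← inner_sub_right]
      simp [direction, PiLp.inner_apply, Fin.sum_univ_three, hu m n]
    rw [← hin]
    simp only [steeringVector]
    rw [← Complex.exp_conj, ← Complex.exp_add]
    simp only [map_mul, Complex.conj_I, Complex.conj_ofReal]
    congr 1
    push_cast
    ring
  simp only [hfun]
  rw [integral_angleLaw_exp]
  simp only [correlationMatrix, Matrix.of_apply]
  rw [EuclideanSpace.norm_eq, Fin.sum_univ_three, hx]
  simp

/-! ### The central limit theorem for random vectors. -/

section CentralLimit

variable {Ω ι : Type*} [MeasurableSpace Ω] {P : Measure Ω} [Fintype ι]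

/-- The matrix of second moments of a random vector. -/
noncomputable def secondMomentMatrix (P : Measure Ω) (X : Ω → EuclideanSpace ℝ ι) :
    Matrix ι ι ℝ :=
  Matrix.of fun i j => ∫ ω, X ω i * X ω j ∂P

lemma memLp_coord {X : Ω → EuclideanSpace ℝ ι} (hX : MemLp X 2 P) (i : ι) :
    MemLp (fun ω => X ω i) 2 P :=
  (EuclideanSpace.proj (𝕜 := ℝ) i).comp_memLp' hX

/-- Gives both the positivity of the matrix and, for centred vectors, the variance of each
projection. -/
lemma dotProduct_secondMomentMatrix_mulVec {X : Ω → EuclideanSpace ℝ ι} (hX : MemLp X 2 P)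
    (t : EuclideanSpace ℝ ι) :
    t.ofLp ⬝ᵥ (secondMomentMatrix P X).mulVec t.ofLp = ∫ ω, (inner ℝ (X ω) t) ^ 2 ∂P := by
  have hint : ∀ i j, Integrable (fun ω => X ω i * X ω j) P := fun i j =>
    (memLp_coord hX i).integrable_mul (memLp_coord hX j)
  have hfun : ∀ ω, (inner ℝ (X ω) t) ^ 2 = ∑ i, ∑ j, t i * t j * (X ω i * X ω j) := by
    intro ω
    rw [PiLp.inner_apply, sq, Finset.sum_mul_sum]
    refine Finset.sum_congr rfl fun i _ => Finset.sum_congr rfl fun j _ => ?_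
    simp only [RCLike.inner_apply, conj_trivial]
    ring
  simp only [hfun]
  rw [integral_finsetSum _ fun i _ => integrable_finsetSum _ fun j _ => (hint i j).const_mul _]
  simp only [dotProduct, Matrix.mulVec, secondMomentMatrix, Matrix.of_apply, Finset.mul_sum]
  refine Finset.sum_congr rfl fun i _ => ?_
  rw [integral_finsetSum _ fun j _ => (hint i j).const_mul _]
  refine Finset.sum_congr rfl fun j _ => ?_
  rw [integral_const_mul]
  ring

lemma posSemidef_secondMomentMatrix {X : Ω → EuclideanSpace ℝ ι} (hX : MemLp X 2 P) :
    (secondMomentMatrix P X).PosSemidef := by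
  refine .of_dotProduct_mulVec_nonneg ?_ fun t => ?_
  · ext i j
    simp only [secondMomentMatrix, Matrix.conjTranspose_apply, Matrix.of_apply, star_trivial,
      mul_comm]
  · rw [star_trivial]
    have := dotProduct_secondMomentMatrix_mulVec hX (WithLp.toLp 2 t)
    simp only at this
    rw [this]
    exact integral_nonneg fun ω => sq_nonneg _

/-- The central limit theorem for centred, square integrable random vectors. -/
theorem tendstoInDistribution_inv_sqrt_smul_sum [DecidableEq ι] [IsProbabilityMeasure P]
    {X : ℕ → Ω → EuclideanSpace ℝ ι} (hX : MemLp (X 0) 2 P) (h0 : ∀ i, ∫ ω, X 0 ω i ∂P = 0)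
    (hindep : iIndepFun X P) (hident : ∀ k, IdentDistrib (X k) (X 0) P P) :
    TendstoInDistribution (fun (n : ℕ) ω => (√n)⁻¹ • ∑ k ∈ Finset.range n, X k ω) atTop id
      (fun _ => P) (multivariateGaussian 0 (secondMomentMatrix P (X 0))) where
  forall_aemeasurable n :=
    (Finset.aemeasurable_fun_sum (Finset.range n) fun k _ =>
      (hident k).aemeasurable_fst).const_smul (√n)⁻¹
  tendsto := by
    refine ProbabilityMeasure.tendsto_iff_tendsto_charFun.2 fun t => ?_
    have hmeas : ∀ n : ℕ, AEMeasurable (fun ω => (√n)⁻¹ • ∑ k ∈ Finset.range n, X k ω) P :=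
      fun n => (Finset.aemeasurable_fun_sum (Finset.range n) fun k _ =>
        (hident k).aemeasurable_fst).const_smul (√n)⁻¹
    have hu : Measurable fun x : EuclideanSpace ℝ ι => inner ℝ x t := by fun_prop
    set Y : ℕ → Ω → ℝ := fun k ω => inner ℝ (X k ω) t with hY
    have hYmeas : ∀ k, AEMeasurable (Y k) P := fun k =>
      hu.comp_aemeasurable (hident k).aemeasurable_fst
    have hY2 : MemLp (Y 0) 2 P := by
      simpa only [hY, real_inner_comm] using hX.const_inner t
    have hY0 : ∫ ω, Y 0 ω ∂P = 0 := by
      simp only [hY, PiLp.inner_apply, RCLike.inner_apply, conj_trivial]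
      rw [integral_finsetSum _ fun i _ =>
        ((memLp_coord hX i).integrable one_le_two).const_mul _]
      simp [integral_const_mul, h0]
    have hvar : Var[Y 0; P] = t.ofLp ⬝ᵥ (secondMomentMatrix P (X 0)).mulVec t.ofLp := by
      rw [variance_of_integral_eq_zero (hYmeas 0) hY0, dotProduct_secondMomentMatrix_mulVec hX]
    have hclt := tendstoInDistribution_inv_sqrt_mul_sum_sub
      (Y := (id : ℝ → ℝ)) (P' := gaussianReal 0 Var[Y 0; P].toNNReal) HasLaw.id hY2
      (hindep.comp (fun _ x => inner ℝ x t) fun _ => hu) (fun k => (hident k).comp hu)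
    -- Cramér–Wold: the characteristic function of the vector at `t` is that of its projection on
    -- `t` at `1`.
    have key := ProbabilityMeasure.tendsto_iff_tendsto_charFun.1 hclt.tendsto 1
    simp only [ProbabilityMeasure.coe_mk, Measure.map_id] at key ⊢
    rw [charFun_multivariateGaussian (posSemidef_secondMomentMatrix hX), ← hvar]
    rw [charFun_gaussianReal, Real.coe_toNNReal _ (variance_nonneg _ _)] at key
    convert! key using 1
    · ext n
      rw [charFun_apply, charFun_apply_real, integral_map (hmeas n) (by fun_prop),
        integral_map _ (by fun_prop)]
      · refine integral_congr_ae (ae_of_all _ fun ω => ?_)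
        simp only [hY0, mul_zero, sub_zero]
        simp only [inner_smul_left, sum_inner, hY]
        simp
      · exact .const_mul (.sub (Finset.aemeasurable_fun_sum _ fun _ _ => hYmeas _)
          aemeasurable_const) _
    · congr 2
      simp

end CentralLimit

/-! ### Complex matrices as real vectors. -/

section RealCoordinates

variable {m n : ℕ}

/-- The real and imaginary parts of the entries of a complex matrix. -/
noncomputable def realCoords (M : Matrix (Fin m) (Fin n) ℂ) :
    EuclideanSpace ℝ ((Fin m × Fin n) ⊕ (Fin m × Fin n)) :=
  WithLp.toLp 2 (Sum.elim (fun p => (M p.1 p.2).re) fun p => (M p.1 p.2).im)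

/-- The complex matrix with given real and imaginary parts of the entries. -/
noncomputable def ofRealCoords :
    EuclideanSpace ℝ ((Fin m × Fin n) ⊕ (Fin m × Fin n)) →L[ℝ] Matrix (Fin m) (Fin n) ℂ where
  toFun x := Matrix.of fun i j => (x (Sum.inl (i, j)) : ℂ) + x (Sum.inr (i, j)) * Complex.I
  map_add' x y := by
    ext i j
    simp only [PiLp.add_apply, Matrix.of_apply, Matrix.add_apply]
    push_cast
    ring
  map_smul' r x := by
    ext i j
    simp only [PiLp.smul_apply, Matrix.of_apply, Matrix.smul_apply, smul_eq_mul, RingHom.id_apply,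
      Complex.real_smul]
    push_cast
    ring
  cont := by
    refine continuous_matrix fun i j => ?_
    simp only [Matrix.of_apply]
    fun_prop

lemma ofRealCoords_apply_re (x : EuclideanSpace ℝ ((Fin m × Fin n) ⊕ (Fin m × Fin n)))
    (i : Fin m) (j : Fin n) : (ofRealCoords x i j).re = x (Sum.inl (i, j)) := by
  simp [ofRealCoords]

lemma ofRealCoords_apply_im (x : EuclideanSpace ℝ ((Fin m × Fin n) ⊕ (Fin m × Fin n)))
    (i : Fin m) (j : Fin n) : (ofRealCoords x i j).im = x (Sum.inr (i, j)) := by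
  simp [ofRealCoords]

lemma ofRealCoords_realCoords (M : Matrix (Fin m) (Fin n) ℂ) :
    ofRealCoords (realCoords M) = M := by
  ext i j
  exact Complex.ext (ofRealCoords_apply_re _ i j) (ofRealCoords_apply_im _ i j)

lemma continuous_realCoords :
    Continuous (realCoords : Matrix (Fin m) (Fin n) ℂ → _) := by
  refine (PiLp.continuous_toLp 2 _).comp (continuous_pi fun k => ?_)
  rcases k with p | p
  · exact Complex.continuous_re.comp (continuous_id.matrix_elem p.1 p.2)
  · exact Complex.continuous_im.comp (continuous_id.matrix_elem p.1 p.2)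

lemma memLp_ofRealCoords_apply
    {μ : Measure (EuclideanSpace ℝ ((Fin m × Fin n) ⊕ (Fin m × Fin n)))} (hμ : MemLp id 2 μ)
    (i : Fin m) (j : Fin n) : MemLp (fun x => ofRealCoords x i j) 2 μ := by
  have h : ∀ a, MemLp (fun x => ((x a : ℝ) : ℂ)) 2 μ := fun a => (memLp_coord hμ a).ofReal
  have hfun : (fun x => ofRealCoords x i j) =
      fun x : EuclideanSpace ℝ ((Fin m × Fin n) ⊕ (Fin m × Fin n)) =>
        (x (Sum.inl (i, j)) : ℂ) + Complex.I * x (Sum.inr (i, j)) := by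
    ext1 x
    simp [ofRealCoords, mul_comm]
  rw [hfun]
  exact (h _).add ((h _).const_mul Complex.I)

end RealCoordinates

/-! ### Complex second moments from real ones. -/

section SecondMoments

variable {Ω Ω' : Type*} [MeasurableSpace Ω] [MeasurableSpace Ω'] {P : Measure Ω} {P' : Measure Ω'}

lemma integral_mul_eq_re_im {F G : Ω → ℂ} (hF : MemLp F 2 P) (hG : MemLp G 2 P) :
    ∫ ω, F ω * G ω ∂P =
      ((∫ ω, (F ω).re * (G ω).re ∂P) - ∫ ω, (F ω).im * (G ω).im ∂P : ℝ) +
      ((∫ ω, (F ω).re * (G ω).im ∂P) + ∫ ω, (F ω).im * (G ω).re ∂P : ℝ) * Complex.I := by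
  have hFG : Integrable (fun ω => F ω * G ω) P := hF.integrable_mul hG
  have hrr : Integrable (fun ω => (F ω).re * (G ω).re) P := hF.re.integrable_mul hG.re
  have hii : Integrable (fun ω => (F ω).im * (G ω).im) P := hF.im.integrable_mul hG.im
  have hri : Integrable (fun ω => (F ω).re * (G ω).im) P := hF.re.integrable_mul hG.im
  have hir : Integrable (fun ω => (F ω).im * (G ω).re) P := hF.im.integrable_mul hG.re
  rw [← integral_re_add_im hFG, ← integral_sub hrr hii, ← integral_add hri hir]
  simp

lemma memLp_conj {F : Ω → ℂ} (hF : MemLp F 2 P) : MemLp (fun ω => conj (F ω)) 2 P :=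
  hF.star

/-- The covariances of complex random variables are determined by those of their parts. -/
lemma integral_mul_conj_congr {F G : Ω → ℂ} {F' G' : Ω' → ℂ}
    (hF : MemLp F 2 P) (hG : MemLp G 2 P) (hF' : MemLp F' 2 P') (hG' : MemLp G' 2 P')
    (hrr : ∫ ω, (F ω).re * (G ω).re ∂P = ∫ ω, (F' ω).re * (G' ω).re ∂P')
    (hri : ∫ ω, (F ω).re * (G ω).im ∂P = ∫ ω, (F' ω).re * (G' ω).im ∂P')
    (hir : ∫ ω, (F ω).im * (G ω).re ∂P = ∫ ω, (F' ω).im * (G' ω).re ∂P')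
    (hii : ∫ ω, (F ω).im * (G ω).im ∂P = ∫ ω, (F' ω).im * (G' ω).im ∂P') :
    ∫ ω, F ω * G ω ∂P = ∫ ω, F' ω * G' ω ∂P' ∧
      ∫ ω, F ω * conj (G ω) ∂P = ∫ ω, F' ω * conj (G' ω) ∂P' := by
  constructor
  · rw [integral_mul_eq_re_im hF hG, integral_mul_eq_re_im hF' hG', hrr, hri, hir, hii]
  · rw [integral_mul_eq_re_im hF (memLp_conj hG), integral_mul_eq_re_im hF' (memLp_conj hG')]
    simp only [Complex.conj_re, Complex.conj_im, mul_neg, integral_neg, hrr, hri, hir, hii]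

end SecondMoments

/-! ### The central limit theorem for complex matrices. -/

lemma integral_eval_multivariateGaussian {ι : Type*} [Fintype ι] [DecidableEq ι]
    (S : Matrix ι ι ℝ) (a : ι) : ∫ x, x a ∂multivariateGaussian 0 S = 0 := by
  have := (EuclideanSpace.proj (𝕜 := ℝ) a).integral_comp_id_comm
    (IsGaussian.integrable_id (μ := multivariateGaussian 0 S))
  simpa using this

lemma integral_mul_multivariateGaussian {ι : Type*} [Fintype ι] [DecidableEq ι]
    {S : Matrix ι ι ℝ} (hS : S.PosSemidef) (a b : ι) :
    ∫ x, x a * x b ∂multivariateGaussian 0 S = S a b := by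
  have hmem : ∀ i, MemLp (fun x : EuclideanSpace ℝ ι => x i) 2 (multivariateGaussian 0 S) :=
    fun i => memLp_coord IsGaussian.memLp_two_id i
  have := covariance_eval_multivariateGaussian (μ := 0) hS a b
  rw [covariance_eq_sub (hmem a) (hmem b), integral_eval_multivariateGaussian, zero_mul, sub_zero] at this
  exact this

/-- The central limit theorem for complex random matrices: the limit is Gaussian, with the mean and
the second moments of the summands. -/
theorem exists_tendstoInDistribution_matrix {Ω : Type*} [MeasurableSpace Ω] {P : Measure Ω}
    [IsProbabilityMeasure P] {m n : ℕ} {A : ℕ → Ω → Matrix (Fin m) (Fin n) ℂ}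
    (hA : ∀ i j, MemLp (fun ω => A 0 ω i j) 2 P) (h0 : ∀ i j, ∫ ω, A 0 ω i j ∂P = 0)
    (hindep : iIndepFun A P) (hident : ∀ k, IdentDistrib (A k) (A 0) P P) :
    ∃ ν : ProbabilityMeasure (Matrix (Fin m) (Fin n) ℂ),
      TendstoInDistribution (fun (L : ℕ) ω => (√L)⁻¹ • ∑ k ∈ Finset.range L, A k ω) atTop
        (id : Matrix (Fin m) (Fin n) ℂ → Matrix (Fin m) (Fin n) ℂ) (fun _ => P)
        (ν : Measure (Matrix (Fin m) (Fin n) ℂ)) ∧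
      IsGaussian (ν : Measure (Matrix (Fin m) (Fin n) ℂ)) ∧
      (∀ i j, ∫ G, G i j ∂(ν : Measure (Matrix (Fin m) (Fin n) ℂ)) = 0) ∧
      ∀ i k j l,
        ∫ G, G i j * G k l ∂(ν : Measure (Matrix (Fin m) (Fin n) ℂ)) =
          ∫ ω, A 0 ω i j * A 0 ω k l ∂P ∧
        ∫ G, G i j * conj (G k l) ∂(ν : Measure (Matrix (Fin m) (Fin n) ℂ)) =
          ∫ ω, A 0 ω i j * conj (A 0 ω k l) ∂P := by
  set X : ℕ → Ω → EuclideanSpace ℝ ((Fin m × Fin n) ⊕ (Fin m × Fin n)) :=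
    fun k ω => realCoords (A k ω) with hXdef
  have hX : MemLp (X 0) 2 P := by
    refine MemLp.of_eval_piLp fun k => ?_
    rcases k with p | p
    · exact (hA p.1 p.2).re
    · exact (hA p.1 p.2).im
  have hX0 : ∀ a, ∫ ω, X 0 ω a ∂P = 0 := by
    intro a
    have hint := fun i j => (hA i j).integrable one_le_two
    rcases a with p | p
    · have := integral_re (hint p.1 p.2)
      rw [h0] at this
      exact this
    · have := integral_im (hint p.1 p.2)
      rw [h0] at this
      exact this
  have hmeas : Measurable (realCoords : Matrix (Fin m) (Fin n) ℂ → _) :=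
    continuous_realCoords.measurable
  have hclt := tendstoInDistribution_inv_sqrt_smul_sum hX hX0
    (hindep.comp (fun _ => realCoords) fun _ => hmeas) (fun k => (hident k).comp hmeas)
  set S := secondMomentMatrix P (X 0) with hS
  have hSpos : S.PosSemidef := posSemidef_secondMomentMatrix hX
  have hTm := (ofRealCoords (m := m) (n := n)).continuous.measurable
  have hν : IsProbabilityMeasure ((multivariateGaussian 0 S).map ofRealCoords) :=
    Measure.isProbabilityMeasure_map hTm.aemeasurable
  have hmemG : ∀ i j, MemLp (fun x => ofRealCoords x i j) 2 (multivariateGaussian 0 S) :=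
    memLp_ofRealCoords_apply IsGaussian.memLp_two_id
  have hent : ∀ i j, Continuous fun G : Matrix (Fin m) (Fin n) ℂ => G i j := fun i j =>
    continuous_id.matrix_elem i j
  refine ⟨⟨(multivariateGaussian 0 S).map ofRealCoords, hν⟩, ?_, ?_, ?_, ?_⟩
  · have h := hclt.continuous_comp ofRealCoords.continuous
    have hfun : (fun L : ℕ => ofRealCoords ∘ fun ω => (√L)⁻¹ • ∑ k ∈ Finset.range L, X k ω) =
        fun (L : ℕ) ω => (√L)⁻¹ • ∑ k ∈ Finset.range L, A k ω := by
      ext1 L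
      ext1 ω
      simp only [Function.comp_apply, map_smul, map_sum, hXdef, ofRealCoords_realCoords]
    have h' : TendstoInDistribution
        (fun L : ℕ => ofRealCoords ∘ fun ω => (√L)⁻¹ • ∑ k ∈ Finset.range L, X k ω) atTop
        ofRealCoords (fun _ => P) (multivariateGaussian 0 S) := h
    rw [hfun] at h'
    -- The limit variable changes from `ofRealCoords` under the Gaussian law to `id` under its
    -- image.
    refine @TendstoInDistribution.mk _ _ _ _ _ _ _ _ _ _ _ _ _ _ (_) hν
      h'.forall_aemeasurable aemeasurable_id ?_
    simpa only [Measure.map_id, ProbabilityMeasure.coe_mk] using h'.tendsto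
  · exact isGaussian_map_of_measurable hTm
  · intro i j
    simp only [ProbabilityMeasure.coe_mk]
    rw [integral_map hTm.aemeasurable (hent i j).aestronglyMeasurable]
    rw [← integral_re_add_im ((hmemG i j).integrable one_le_two)]
    simp only [RCLike.re_to_complex, RCLike.im_to_complex, ofRealCoords_apply_re,
      ofRealCoords_apply_im,
      integral_eval_multivariateGaussian]
    simp
  · intro i k j l
    simp only [ProbabilityMeasure.coe_mk]
    have hmul : Continuous fun G : Matrix (Fin m) (Fin n) ℂ => G i j * G k l :=
      (hent i j).mul (hent k l)
    have hmulc : Continuous fun G : Matrix (Fin m) (Fin n) ℂ => G i j * conj (G k l) :=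
      (hent i j).mul (Complex.continuous_conj.comp (hent k l))
    rw [integral_map hTm.aemeasurable hmul.aestronglyMeasurable,
      integral_map hTm.aemeasurable hmulc.aestronglyMeasurable]
    refine integral_mul_conj_congr (hmemG i j) (hmemG k l) (hA i j) (hA k l) ?_ ?_ ?_ ?_ <;>
    · simp only [ofRealCoords_apply_re, ofRealCoords_apply_im]
      rw [integral_mul_multivariateGaussian hSpos]
      rfl

/-! ### Moments of a single path. -/

lemma continuous_direction : Continuous direction := by
  unfold direction
  refine (PiLp.continuous_toLp 2 _).comp (continuous_pi fun i => ?_)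
  fin_cases i <;> simp <;> fun_prop

lemma continuous_steeringVector (κ : ℝ) {N : ℕ} (u : Fin N → EuclideanSpace ℝ (Fin 3)) (n : Fin N) :
    Continuous fun Ψ => steeringVector κ u Ψ n := by
  have := continuous_direction
  unfold steeringVector
  fun_prop

lemma norm_steeringVector (κ : ℝ) {N : ℕ} (u : Fin N → EuclideanSpace ℝ (Fin 3)) (Ψ : ℝ × ℝ)
    (n : Fin N) : ‖steeringVector κ u Ψ n‖ = 1 := by
  rw [steeringVector, mul_comm, Complex.norm_exp_ofReal_mul_I]

/-- The contribution of a path with given gain and angles to the channel matrix. -/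
noncomputable def pathMatrix (κ : ℝ) {Nrx Ntx : ℕ} (urx : Fin Nrx → EuclideanSpace ℝ (Fin 3))
    (utx : Fin Ntx → EuclideanSpace ℝ (Fin 3)) (p : ℂ × (ℝ × ℝ) × (ℝ × ℝ)) :
    Matrix (Fin Nrx) (Fin Ntx) ℂ :=
  p.1 • Matrix.vecMulVec (steeringVector κ urx p.2.1) (star (steeringVector κ utx p.2.2))

section PathMatrix

variable (κ : ℝ) {Nrx Ntx : ℕ} (urx : Fin Nrx → EuclideanSpace ℝ (Fin 3))
  (utx : Fin Ntx → EuclideanSpace ℝ (Fin 3))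

lemma pathMatrix_apply (p : ℂ × (ℝ × ℝ) × (ℝ × ℝ)) (i : Fin Nrx) (j : Fin Ntx) :
    pathMatrix κ urx utx p i j =
      p.1 * (steeringVector κ urx p.2.1 i * conj (steeringVector κ utx p.2.2 j)) := rfl

lemma continuous_pathMatrix : Continuous (pathMatrix κ urx utx) := by
  refine continuous_matrix fun i j => ?_
  simp only [pathMatrix_apply]
  have h1 := (continuous_steeringVector κ urx i).comp
    (continuous_fst.comp (continuous_snd (X := ℂ) (Y := (ℝ × ℝ) × (ℝ × ℝ))))
  have h2 := (continuous_steeringVector κ utx j).comp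
    (continuous_snd.comp (continuous_snd (X := ℂ) (Y := (ℝ × ℝ) × (ℝ × ℝ))))
  exact continuous_fst.mul (h1.mul (Complex.continuous_conj.comp h2))

lemma norm_pathMatrix_apply (p : ℂ × (ℝ × ℝ) × (ℝ × ℝ)) (i : Fin Nrx) (j : Fin Ntx) :
    ‖pathMatrix κ urx utx p i j‖ = ‖p.1‖ := by
  simp [pathMatrix_apply, norm_steeringVector]

variable {κ urx utx} {Ω : Type*} [MeasurableSpace Ω] {P : Measure Ω} {c : Ω → ℂ}
  {Ψrx Ψtx : Ω → ℝ × ℝ}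

/-- Expectations of products factorize over a gain and two angles that are independent. -/
lemma integral_gain_mul_angles [IsProbabilityMeasure P] (hc : AEMeasurable c P)
    (hrx : HasLaw Ψrx angleLaw P) (htx : HasLaw Ψtx angleLaw P)
    (h_gain : IndepFun c (fun ω => (Ψrx ω, Ψtx ω)) P) (h_angles : IndepFun Ψrx Ψtx P)
    {p : ℂ → ℂ} {g h : ℝ × ℝ → ℂ} (hp : Continuous p) (hg : Continuous g) (hh : Continuous h) :
    ∫ ω, p (c ω) * (g (Ψrx ω) * h (Ψtx ω)) ∂P =
      (∫ ω, p (c ω) ∂P) * ((∫ Ψ, g Ψ ∂angleLaw) * ∫ Ψ, h Ψ ∂angleLaw) := by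
  have hgm := hg.measurable
  have hhm := hh.measurable
  have hrxm := hrx.aemeasurable
  have htxm := htx.aemeasurable
  have h1 := (h_gain.comp hp.measurable
    (show Measurable fun q : (ℝ × ℝ) × (ℝ × ℝ) => g q.1 * h q.2 by
      fun_prop)).integral_fun_mul_eq_mul_integral
    (hp.measurable.comp_aemeasurable hc).aestronglyMeasurable
    (((hgm.comp_aemeasurable hrxm).mul (hhm.comp_aemeasurable htxm)).aestronglyMeasurable)
  have h2 := (h_angles.comp hgm hhm).integral_fun_mul_eq_mul_integral
    (hgm.comp_aemeasurable hrxm).aestronglyMeasurable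
    (hhm.comp_aemeasurable htxm).aestronglyMeasurable
  rw [hrx.integral_comp hg.aestronglyMeasurable, htx.integral_comp hh.aestronglyMeasurable] at h2
  simp only [Function.comp_apply] at h1 h2
  rw [h1]
  congr 1

lemma integral_pathMatrix_apply [IsProbabilityMeasure P] (hc : AEMeasurable c P)
    (hc_mean : ∫ ω, c ω ∂P = 0)
    (hrx : HasLaw Ψrx angleLaw P) (htx : HasLaw Ψtx angleLaw P)
    (h_gain : IndepFun c (fun ω => (Ψrx ω, Ψtx ω)) P) (h_angles : IndepFun Ψrx Ψtx P)
    (i : Fin Nrx) (j : Fin Ntx) :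
    ∫ ω, pathMatrix κ urx utx (c ω, Ψrx ω, Ψtx ω) i j ∂P = 0 := by
  simp only [pathMatrix_apply]
  rw [integral_gain_mul_angles hc hrx htx h_gain h_angles (p := fun z => z)
    (g := fun Ψ => steeringVector κ urx Ψ i) (h := fun Ψ => conj (steeringVector κ utx Ψ j))
    continuous_id
    (continuous_steeringVector κ urx i)
    (Complex.continuous_conj.comp (continuous_steeringVector κ utx j)), hc_mean, zero_mul]

lemma integral_pathMatrix_mul [IsProbabilityMeasure P] (hc : AEMeasurable c P)
    (hc_sq : ∫ ω, c ω ^ 2 ∂P = 0)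
    (hrx : HasLaw Ψrx angleLaw P) (htx : HasLaw Ψtx angleLaw P)
    (h_gain : IndepFun c (fun ω => (Ψrx ω, Ψtx ω)) P) (h_angles : IndepFun Ψrx Ψtx P)
    (i k : Fin Nrx) (j l : Fin Ntx) :
    ∫ ω, pathMatrix κ urx utx (c ω, Ψrx ω, Ψtx ω) i j *
      pathMatrix κ urx utx (c ω, Ψrx ω, Ψtx ω) k l ∂P = 0 := by
  have hfac := integral_gain_mul_angles hc hrx htx h_gain h_angles (p := fun z => z ^ 2)
    (g := fun Ψ => steeringVector κ urx Ψ i * steeringVector κ urx Ψ k)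
    (h := fun Ψ => conj (steeringVector κ utx Ψ j) * conj (steeringVector κ utx Ψ l))
    (continuous_pow 2)
    ((continuous_steeringVector κ urx i).mul (continuous_steeringVector κ urx k))
    ((Complex.continuous_conj.comp (continuous_steeringVector κ utx j)).mul
      (Complex.continuous_conj.comp (continuous_steeringVector κ utx l)))
  rw [hc_sq, zero_mul] at hfac
  rw [← hfac]
  refine integral_congr_ae (ae_of_all _ fun ω => ?_)
  simp only [pathMatrix_apply]
  ring

/-- The transmit vector enters conjugated, so its indices appear in the order `l, j`. -/
lemma integral_pathMatrix_mul_conj [IsProbabilityMeasure P] (hc : AEMeasurable c P) {σ : ℝ}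
    (hc_var : ∫ ω, ‖c ω‖ ^ 2 ∂P = σ ^ 2) (hurx : IsPlanarArray urx) (hutx : IsPlanarArray utx)
    (hrx : HasLaw Ψrx angleLaw P) (htx : HasLaw Ψtx angleLaw P)
    (h_gain : IndepFun c (fun ω => (Ψrx ω, Ψtx ω)) P) (h_angles : IndepFun Ψrx Ψtx P)
    (i k : Fin Nrx) (j l : Fin Ntx) :
    ∫ ω, pathMatrix κ urx utx (c ω, Ψrx ω, Ψtx ω) i j *
      conj (pathMatrix κ urx utx (c ω, Ψrx ω, Ψtx ω) k l) ∂P =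
      ((σ : ℂ) • correlationMatrix κ urx) i k * ((σ : ℂ) • correlationMatrix κ utx) l j := by
  have hfac := integral_gain_mul_angles hc hrx htx h_gain h_angles
    (p := fun z => ((‖z‖ ^ 2 : ℝ) : ℂ))
    (g := fun Ψ => steeringVector κ urx Ψ i * conj (steeringVector κ urx Ψ k))
    (h := fun Ψ => steeringVector κ utx Ψ l * conj (steeringVector κ utx Ψ j)) (by fun_prop)
    ((continuous_steeringVector κ urx i).mul
      (Complex.continuous_conj.comp (continuous_steeringVector κ urx k)))
    ((continuous_steeringVector κ utx l).mul
      (Complex.continuous_conj.comp (continuous_steeringVector κ utx j)))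
  rw [integral_complex_ofReal, hc_var, integral_steeringVector_mul_conj κ hurx,
    integral_steeringVector_mul_conj κ hutx] at hfac
  have hrhs : ((σ : ℂ) • correlationMatrix κ urx) i k * ((σ : ℂ) • correlationMatrix κ utx) l j =
      ((σ ^ 2 : ℝ) : ℂ) * (correlationMatrix κ urx i k * correlationMatrix κ utx l j) := by
    simp only [Matrix.smul_apply, smul_eq_mul]
    push_cast
    ring
  rw [hrhs, ← hfac]
  refine integral_congr_ae (ae_of_all _ fun ω => ?_)
  simp only [pathMatrix_apply, map_mul, Complex.conj_conj]
  push_cast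
  rw [← Complex.mul_conj']
  ring

end PathMatrix

/-! ### The limit law of the channel. -/

theorem lemma1 {Ω : Type*} [MeasurableSpace Ω] (P : Measure Ω) [IsProbabilityMeasure P]
    (Nrx Ntx : ℕ) (lam : ℝ) (hlam : 0 < lam)
    (urx : Fin Nrx → EuclideanSpace ℝ (Fin 3)) (utx : Fin Ntx → EuclideanSpace ℝ (Fin 3))
    (hurx : IsPlanarArray urx) (hutx : IsPlanarArray utx)
    (c : ℕ → Ω → ℂ) (Ψrx Ψtx : ℕ → Ω → ℝ × ℝ) (σc : ℝ) (hσc : 0 ≤ σc)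
    -- the path gains are identically distributed, with mean zero and variance `σc ^ 2`
    (hc_ident : ∀ ℓ, IdentDistrib (c ℓ) (c 0) P P)
    (hc_sq : MemLp (c 0) 2 P)
    (hc_mean : ∫ ω, c 0 ω ∂P = 0)
    (hc_var : ∫ ω, ‖c 0 ω‖ ^ 2 ∂P = σc ^ 2)
    -- all the angles have the density `cos θ / (2π)`
    (hrx_law : ∀ ℓ, HasLaw (Ψrx ℓ) angleLaw P)
    (htx_law : ∀ ℓ, HasLaw (Ψtx ℓ) angleLaw P)
    -- all the gains and all the angles are mutually independent
    (h_indep_paths : iIndepFun (fun ℓ ω => (c ℓ ω, Ψrx ℓ ω, Ψtx ℓ ω)) P)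
    (h_indep_gain : ∀ ℓ, IndepFun (c ℓ) (fun ω => (Ψrx ℓ ω, Ψtx ℓ ω)) P)
    (h_indep_angles : ∀ ℓ, IndepFun (Ψrx ℓ) (Ψtx ℓ) P) :
    ∃ ν : ProbabilityMeasure (Matrix (Fin Nrx) (Fin Ntx) ℂ),
      TendstoInDistribution (nlosChannel (waveNumber lam) urx utx c Ψrx Ψtx) atTop
        (id : Matrix (Fin Nrx) (Fin Ntx) ℂ → Matrix (Fin Nrx) (Fin Ntx) ℂ)
        (fun _ => P) (ν : Measure (Matrix (Fin Nrx) (Fin Ntx) ℂ)) ∧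
      IsGaussianMatrixLaw 0
        ((σc : ℂ) • correlationMatrix (waveNumber lam) urx)
        ((σc : ℂ) • correlationMatrix (waveNumber lam) utx)
        (ν : Measure (Matrix (Fin Nrx) (Fin Ntx) ℂ)) ∧
      (∫ ω, c 0 ω ^ 2 ∂P = 0 →
        IsMatrixComplexNormal 0
          ((σc : ℂ) • correlationMatrix (waveNumber lam) urx)
          ((σc : ℂ) • correlationMatrix (waveNumber lam) utx)
          (ν : Measure (Matrix (Fin Nrx) (Fin Ntx) ℂ))) := by
  have hc_meas := (hc_ident 0).aemeasurable_snd
  have hpath : Measurable (pathMatrix (waveNumber lam) urx utx) :=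
    (continuous_pathMatrix _ _ _).measurable
  have hlaw : ∀ {Z : ℕ → Ω → ℝ × ℝ}, (∀ ℓ, HasLaw (Z ℓ) angleLaw P) →
      ∀ ℓ, IdentDistrib (Z ℓ) (Z 0) P P := fun hZ ℓ =>
    ⟨(hZ ℓ).aemeasurable, (hZ 0).aemeasurable, (hZ ℓ).map_eq.trans (hZ 0).map_eq.symm⟩
  obtain ⟨ν, hν, hgauss, hmean, hmoments⟩ := exists_tendstoInDistribution_matrix
    (A := fun ℓ ω => pathMatrix (waveNumber lam) urx utx (c ℓ ω, Ψrx ℓ ω, Ψtx ℓ ω))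
    (fun i j => hc_sq.of_le
      (((continuous_id.matrix_elem i j).measurable.comp hpath).comp_aemeasurable
        (hc_meas.prodMk ((hrx_law 0).aemeasurable.prodMk
          (htx_law 0).aemeasurable))).aestronglyMeasurable
      (ae_of_all _ fun ω => (norm_pathMatrix_apply _ _ _ _ i j).le))
    (integral_pathMatrix_apply hc_meas hc_mean (hrx_law 0) (htx_law 0) (h_indep_gain 0)
      (h_indep_angles 0))
    (h_indep_paths.comp (fun _ => pathMatrix (waveNumber lam) urx utx) fun _ => hpath)
    -- Equal marginals give equal joint laws because gain and angles are independent within each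
    -- path.
    (fun ℓ => ((hc_ident ℓ).prodMk ((hlaw hrx_law ℓ).prodMk (hlaw htx_law ℓ) (h_indep_angles ℓ)
      (h_indep_angles 0)) (h_indep_gain ℓ) (h_indep_gain 0)).comp hpath)
  have hlimit : IsGaussianMatrixLaw 0
      ((σc : ℂ) • correlationMatrix (waveNumber lam) urx)
      ((σc : ℂ) • correlationMatrix (waveNumber lam) utx)
      (ν : Measure (Matrix (Fin Nrx) (Fin Ntx) ℂ)) := by
    refine ⟨hgauss, hmean, fun i k j l => ?_⟩
    simp only [Matrix.zero_apply, sub_zero]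
    rw [(hmoments i k j l).2]
    exact integral_pathMatrix_mul_conj hc_meas hc_var hurx hutx (hrx_law 0) (htx_law 0)
      (h_indep_gain 0) (h_indep_angles 0) i k j l
  refine ⟨ν, ?_, hlimit, fun hproper => ⟨hlimit, fun i k j l => ?_⟩⟩
  -- Only the scalar differs: complex `1 / √L` against real `(√L)⁻¹`.
  · convert! hν using 1
    ext1 L
    ext1 ω
    rw [nlosChannel, one_div]
    ext i j
    rw [Matrix.smul_apply, Matrix.smul_apply, Complex.real_smul, smul_eq_mul]
    rfl
  · simp only [Matrix.zero_apply, sub_zero]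
    rw [(hmoments i k j l).1]
    exact integral_pathMatrix_mul hc_meas hproper (hrx_law 0) (htx_law 0) (h_indep_gain 0)
      (h_indep_angles 0) i k j l
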